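/- Let $\Omega$ be a non-empty compact Hausdorff space with its Baire $\sigma$-algebra, and let $\mathcal P(\Omega)$ be the set of all probability measures on $\Omega$ with the weak$^*$ topology (the coarsest one making $p\mapsto\int f\,dp$ continuous for all $f\in C(\Omega)$). For a probability measure $P$ on $\mathcal P(\Omega)$ concentrated on a finite set, let $D(P)\subseteq\mathcal P(\Omega)$ be the smallest finite set of $P$-probability one. A function $f:\Omega\to\mathbb R$ is *strongly upper semicontinuous* if there are bounded above continuous functions $f_1\ge f_2\ge\cdots$ from $\Omega$ to $\mathbb R$ that converge to $f$ everywhere. Consider the following perfect-information game. Put $\mathcal K_0:=1$ and $\mathcal F_0:=1$. On each round $n=1,2,\dots$, in this order: - Sceptic announces a function $S_n:\Omega\times\mathcal P(\Omega)\to\mathbb R$ that is strongly upper semicontinuous in the first argument $\omega\in\Omega$ and satisfies $\int_\Omega S_n(\omega,p)\,p(d\omega)\le 0$ for all $p\in\mathcal P(\Omega)$; - Forecaster announces a probability measure $P_n$ on $\mathcal P(\Omega)$ concentrated on a finite set; - Reality announces $\omega_n\in\Omega$; - Forecaster announces $f_n:\mathcal P(\Omega)\to\mathbb R$ with $\int f_n\,dP_n\le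 0$; - Random Number Generator announces $p_n\in D(P_n)$; - $\mathcal K_n:=\mathcal K_{n-1}+S_n(\omega_n,p_n)$ and $\mathcal F_n:=\mathcal F_{n-1}+f_n(p_n)$. Sceptic must choose $S_n$ so that $\mathcal K_n\ge 0$ no matter how the other players move, and Forecaster must choose his moves so that $\mathcal F_n\ge 0$ no matter how the other players move. **Corollary.** For any $\epsilon>0$ and any sequence $\mathcal A_1,\mathcal A_2,\dots$ of open covers of $\mathcal P(\Omega)$, Forecaster has a (legal) strategy in this game that guarantees, for each $n$: - $\mathcal K_n\le(1+\epsilon)\mathcal F_n$; - $D(P_n)$ lies completely in one element of $\mathcal A_n$; - $|D(P_n)|\le|\Omega|$. -/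

import Mathlib

open Set Filter Topology MeasureTheory
open Convexity (StdSimplex)

namespace DefensiveForecasting

/-- The Baire σ-algebra of a topological space: the smallest σ-algebra that makes all continuous
real-valued functions measurable. -/
@[reducible] def baire (Ω : Type*) [TopologicalSpace Ω] : MeasurableSpace Ω :=
  ⨆ f : C(Ω, ℝ), MeasurableSpace.comap f (borel ℝ)

/-- `Prob Ω` is the set of all probability measures on the Baire σ-algebra of `Ω`. -/
def Prob (Ω : Type*) [TopologicalSpace Ω] : Type _ :=
  {μ : @Measure Ω (baire Ω) // IsProbabilityMeasure μ}

/-- The weak* topology on `Prob Ω`: the coarsest topology for which `p ↦ ∫ f dp` is continuous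
for every continuous `f : Ω → ℝ`. -/
noncomputable instance Prob.instTopologicalSpace (Ω : Type*) [TopologicalSpace Ω] :
    TopologicalSpace (Prob Ω) :=
  TopologicalSpace.induced (fun (p : Prob Ω) (f : C(Ω, ℝ)) => ∫ ω, f ω ∂p.1) Pi.topologicalSpace

/-- A real function is strongly upper semicontinuous if it is the everywhere limit of a
decreasing sequence of bounded above continuous real functions. -/
def StronglyUpperSemicontinuous {Ω : Type*} [TopologicalSpace Ω] (f : Ω → ℝ) : Prop :=
  ∃ g : ℕ → Ω → ℝ, (∀ k, Continuous (g k)) ∧ (∀ k, BddAbove (range (g k))) ∧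
    (∀ k ω, g (k + 1) ω ≤ g k ω) ∧ ∀ ω, Tendsto (fun k => g k ω) atTop (𝓝 (f ω))

/-- The probability measures on `Prob Ω` concentrated on a finite set, given by their point
weights: finitely supported, nonnegative, with sum `1`. -/
abbrev FinProb (Ω : Type*) [TopologicalSpace Ω] : Type _ := StdSimplex ℝ (Prob Ω)

/-- The smallest finite set of `P`-probability one. -/
def FinProb.D {Ω : Type*} [TopologicalSpace Ω] (P : FinProb Ω) : Finset (Prob Ω) :=
  P.weights.support

/-- The integral `∫ f dP`, a finite sum. -/
noncomputable def FinProb.integral {Ω : Type*} [TopologicalSpace Ω] (P : FinProb Ω) (f : Prob Ω → ℝ) : ℝ :=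
  ∑ p ∈ P.D, P.weights p * f p

/-- All the moves made in one round of the randomized game. -/
structure Round (Ω : Type*) [TopologicalSpace Ω] where
  /-- Sceptic's move `S_n(ω, p)`. -/
  S : Ω → Prob Ω → ℝ
  /-- Forecaster's randomized forecast `P_n`. -/
  P : FinProb Ω
  /-- Reality's move `ω_n`. -/
  outcome : Ω
  /-- Forecaster's bet `f_n` against Random Number Generator. -/
  f : Prob Ω → ℝ
  /-- Random Number Generator's move `p_n`. -/
  p : Prob Ω

/-- A play of the game: the moves of all rounds (round `n` here is the `(n+1)`-st round). -/
abbrev Play (Ω : Type*) [TopologicalSpace Ω] : Type _ := ℕ → Round Ω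

/-- A strategy for Forecaster in the perfect-information game. In each round, `forecast` yields
`P_n` from the previous rounds and Sceptic's move, and `bet` yields `f_n` from the previous
rounds, Sceptic's move and Reality's move. -/
structure ForecasterStrategy (Ω : Type*) [TopologicalSpace Ω] where
  forecast : (n : ℕ) → (Fin n → Round Ω) → (Ω → Prob Ω → ℝ) → FinProb Ω
  bet : (n : ℕ) → (Fin n → Round Ω) → (Ω → Prob Ω → ℝ) → Ω → Prob Ω → ℝ

namespace Play

variable {Ω : Type*} [TopologicalSpace Ω]

/-- The rounds preceding round `n`. -/
def history (π : Play Ω) (n : ℕ) : Fin n → Round Ω := fun i => π i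

/-- Sceptic's capital after `n` rounds. -/
noncomputable def K (π : Play Ω) : ℕ → ℝ
  | 0 => 1
  | n + 1 => K π n + (π n).S (π n).outcome (π n).p

/-- Forecaster's capital after `n` rounds. -/
noncomputable def F (π : Play Ω) : ℕ → ℝ
  | 0 => 1
  | n + 1 => F π n + (π n).f (π n).p

/-- Sceptic's move in round `n` is allowed: it is strongly upper semicontinuous in `ω`, has
nonpositive expectation under every forecast, and keeps his capital nonnegative however the other
players move in this round. By the first and the last condition `S_n(·, p)` is bounded and
measurable, so the integral is a genuine one. -/
def ScepticLegal (π : Play Ω) (n : ℕ) : Prop :=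
  (∀ p : Prob Ω, StronglyUpperSemicontinuous fun ω => (π n).S ω p) ∧
  (∀ p : Prob Ω, ∫ ω, (π n).S ω p ∂p.1 ≤ 0) ∧
  ∀ (P : FinProb Ω) (ω : Ω), ∀ p ∈ P.D, 0 ≤ π.K n + (π n).S ω p

/-- Random Number Generator's move in round `n` is allowed. -/
def RNGLegal (π : Play Ω) (n : ℕ) : Prop := (π n).p ∈ (π n).P.D

/-- In round `n` Forecaster makes both of his moves according to the strategy `σ`. -/
def Follows (π : Play Ω) (σ : ForecasterStrategy Ω) (n : ℕ) : Prop :=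
  (π n).P = σ.forecast n (π.history n) (π n).S ∧
  (π n).f = σ.bet n (π.history n) (π n).S (π n).outcome

/-- Forecaster's moves in round `n` are allowed: his bet has nonpositive expectation, and his
capital after the round is nonnegative. -/
def ForecasterLegal (π : Play Ω) (n : ℕ) : Prop :=
  (π n).P.integral (π n).f ≤ 0 ∧ 0 ≤ π.F (n + 1)

end Play

end DefensiveForecasting

open DefensiveForecasting

/-! Everything rests on a one-round claim: against every legal S and every δ > 0 there is a finitely
supported P, inside one element of the cover and with at most |Ω| points, for which the P-average of
S(ω, ·) is at most δ for all ω. With δ = ε/2^n in the n-th round, the bet (S - δ)/(1 + ε) is fair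
and keeps (1 + ε)F = K + ε/2^n; since K ≥ 0, both capital bounds follow.

For the claim (`exists_randomized_forecast`), choose continuous g_p ≥ S(·, p) with ∫ g_p dp < δ/2;
the inequality persists for q near p. A partition of unity φ glues these into H_q = Σ φ_p(q) g_p,
continuous in q, with ∫ H_q dq ≤ δ/2. A minimax theorem (`exists_forecast`) yields q with H_q ≤ δ
everywhere, and P gives p the weight φ_p(q). A barycentric refinement keeps the support in one
element of the cover, and a Carathéodory-type exchange (`exists_weights_vanishing`) trims it to |Ω|
points.

In the minimax theorem, compactness of `Prob Ω` leaves finitely many outcomes, hence an approximate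
equilibrium on a simplex (`exists_approx_equilibrium`). This Brouwer-type statement comes from
Scarf's parity argument (`IsSlackRanking.exists_colourful`), applied to grid points ranked by each
coordinate. -/

namespace DefensiveForecasting

/-! ### Scarf's lemma by a door-and-room parity argument -/

section Scarf

variable {T I : Type*}

/-- A finite set `R` is dominant for the rankings `u i` if every point is ranked weakly below all of
`R` by at least one of them. -/
def Dominant {V : Type*} (u : I → V → ℕ) (R : Finset V) : Prop :=
  ∀ v, ∃ i, ∀ x ∈ R, u i v ≤ u i x

lemma Dominant.mono {V : Type*} {u : I → V → ℕ} {R R' : Finset V} (h : Dominant u R)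
    (hR : R' ⊆ R) : Dominant u R' := fun v =>
  let ⟨i, hi⟩ := h v
  ⟨i, fun x hx => hi x (hR hx)⟩

variable [Fintype I]

/-- If adding `x` to a set `d` of `|I| - 1` points keeps it dominant, then `x` comes below all of
`d` in exactly one ranking. Such a ranking is one of the two in which the minimum of `d` is the
same. -/
lemma Dominant.insert_lowest {V : Type*} [DecidableEq V] [DecidableEq I] {u : I → V → ℕ}
    (hu : ∀ i, Function.Injective (u i)) {d : Finset V} (hcard : d.card + 1 = Fintype.card I)
    {μ : I → V} (hμ : ∀ i, μ i ∈ d) (hμle : ∀ i, ∀ y ∈ d, u i (μ i) ≤ u i y)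
    {i₁ i₂ : I} (hne : i₁ ≠ i₂) (heq : μ i₁ = μ i₂)
    {x : V} (hx : x ∉ d) (hdom : Dominant u (insert x d)) :
    ∃ k, (k = i₁ ∨ k = i₂) ∧ ∀ i, u i x < u i (μ i) ↔ i = k := by
  classical
  obtain ⟨k, hk⟩ := hdom x
  have hkx : u k x < u k (μ k) := by
    refine lt_of_le_of_ne (hk _ (Finset.mem_insert_of_mem (hμ k))) fun h => hx ?_
    rw [hu k h]; exact hμ k
  -- The rankings in which `x` is not lowest map onto `d` under `μ`. They omit `k`, so by counting
  -- they are all the others and `μ` is injective on them; hence `k` is `i₁` or `i₂`.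
  have hsurj : ∀ y ∈ d, ∃ i, ¬ u i x < u i (μ i) ∧ μ i = y := by
    intro y hy
    obtain ⟨i, hi⟩ := hdom y
    have h1 : μ i = y := hu i (le_antisymm (hμle i y hy) (hi _ (Finset.mem_insert_of_mem (hμ i))))
    refine ⟨i, not_lt.2 ?_, h1⟩
    rw [h1]; exact hi x (Finset.mem_insert_self _ _)
  have hsub : d ⊆ (Finset.univ.filter fun i => ¬ u i x < u i (μ i)).image μ := by
    intro y hy
    obtain ⟨i, h1, h2⟩ := hsurj y hy
    exact Finset.mem_image.2 ⟨i, by simpa using h1, h2⟩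
  have hsubk : (Finset.univ.filter fun i => ¬ u i x < u i (μ i)) ⊆ Finset.univ.erase k := by
    intro i hi
    simp only [Finset.mem_filter, Finset.mem_univ, true_and] at hi
    exact Finset.mem_erase.2 ⟨fun h => hi (h ▸ hkx), Finset.mem_univ _⟩
  have hce : (Finset.univ.erase k).card = d.card := by
    rw [Finset.card_erase_of_mem (Finset.mem_univ _), Finset.card_univ]; omega
  have hcle := (Finset.card_le_card hsub).trans Finset.card_image_le
  have heqk := Finset.eq_of_subset_of_card_le hsubk (hce ▸ hcle)
  refine ⟨k, ?_, fun i => ⟨fun h => ?_, fun h => h ▸ hkx⟩⟩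
  · by_contra! hcon
    have himg : ((Finset.univ.erase k).image μ).card = (Finset.univ.erase k).card := by
      refine le_antisymm Finset.card_image_le ?_
      rw [hce, ← heqk]; exact Finset.card_le_card hsub
    exact hne (Finset.card_image_iff.1 himg (by simpa using hcon.1.symm)
      (by simpa using hcon.2.symm) heq)
  · by_contra hik
    have : i ∈ Finset.univ.erase k := Finset.mem_erase.2 ⟨hik, Finset.mem_univ _⟩
    rw [← heqk] at this
    simp only [Finset.mem_filter] at this
    exact this.2 h

/-- The rankings `u i` of `T ⊕ I` treat the points of `I` as slack: `i` is lowest in its own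
ranking, and higher than all of `T` in the others. -/
structure IsSlackRanking (u : I → T ⊕ I → ℕ) : Prop where
  injective : ∀ i, Function.Injective (u i)
  low : ∀ i v, v ≠ Sum.inr i → u i (Sum.inr i) < u i v
  high : ∀ i j t, i ≠ j → u i (Sum.inl t) < u i (Sum.inr j)

variable [Fintype T] [DecidableEq T] [DecidableEq I] {u : I → T ⊕ I → ℕ}

/-- A dominant set of `|I| - 1` points, not all of them slack, lies in exactly two dominant sets of
`|I|` points. -/
lemma IsSlackRanking.card_insert_eq_two (hu : IsSlackRanking u) {d : Finset (T ⊕ I)}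
    (hd : Dominant u d) (hcard : d.card + 1 = Fintype.card I) {t : T} (ht : Sum.inl t ∈ d)
    {rooms : Finset (Finset (T ⊕ I))}
    (hrooms : ∀ R, R ∈ rooms ↔ Dominant u R ∧ R.card = Fintype.card I) :
    (rooms.filter fun R => d ⊆ R).card = 2 := by
  classical
  have hmin : ∀ i, ∃ y ∈ d, ∀ z ∈ d, u i y ≤ u i z := fun i => d.exists_min_image (u i) ⟨_, ht⟩
  choose μ hμ hμle using hmin
  obtain ⟨i₁, -, i₂, -, hne, heq⟩ := Finset.exists_ne_map_eq_of_card_lt_of_maps_to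
    (s := Finset.univ) (t := d) (by rw [Finset.card_univ]; omega) (f := μ) (fun i _ => hμ i)
  have hlow := fun {x} => Dominant.insert_lowest (x := x) hu.injective hcard hμ hμle hne heq
  have huniq : ∀ k x x', x ∉ d → x' ∉ d → Dominant u (insert x d) → Dominant u (insert x' d) →
      u k x < u k (μ k) → u k x' < u k (μ k) → u k x' ≤ u k x := by
    intro k x x' hx hx' hD hD' hkx hkx'
    by_contra! hlt
    obtain ⟨i, hi⟩ := hD x'
    obtain ⟨k', -, hk'⟩ := hlow hx' hD'
    have hik : u i x' < u i (μ i) := by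
      refine lt_of_le_of_ne (hi _ (Finset.mem_insert_of_mem (hμ i))) fun h => hx' ?_
      rw [hu.injective i h]; exact hμ i
    have : i = k := ((hk' i).1 hik).trans ((hk' k).1 hkx').symm
    subst this
    exact absurd (hi x (Finset.mem_insert_self _ _)) (not_le.2 hlt)
  have hex : ∀ k, (∀ y ∈ d, ∃ i, i ≠ k ∧ μ i = y) →
      ∃ x, x ∉ d ∧ Dominant u (insert x d) ∧ u k x < u k (μ k) := by
    intro k hk
    -- The entering point is the `k`-highest among the points above the minima of `d` in all other
    -- rankings. The slack point `k` is a candidate because `d` contains `t`. A violation of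
    -- dominance would be another candidate, `k`-higher than `x`.
    obtain ⟨x, hxM, hxmax⟩ := (Finset.univ.filter fun v => ∀ i, i ≠ k → u i (μ i) < u i v)
      |>.exists_max_image (u k) ⟨Sum.inr k, by
        simp only [Finset.mem_filter, Finset.mem_univ, true_and]
        exact fun i hi => (hμle i _ ht).trans_lt (hu.high i k t hi)⟩
    simp only [Finset.mem_filter, Finset.mem_univ, true_and] at hxM hxmax
    have hxd : x ∉ d := by
      intro hx
      obtain ⟨i, hik, rfl⟩ := hk x hx
      exact lt_irrefl _ (hxM i hik)
    have hkx : u k x < u k (μ k) := by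
      obtain ⟨i, hi⟩ := hd x
      have hik : i = k := by
        by_contra hik
        exact absurd (hi _ (hμ i)) (not_le.2 (hxM i hik))
      subst hik
      refine lt_of_le_of_ne (hi _ (hμ i)) fun h => hxd ?_
      rw [hu.injective i h]; exact hμ i
    refine ⟨x, hxd, fun v => ?_, hkx⟩
    by_contra! hcon
    have hle : u k v ≤ u k x := by
      refine hxmax v fun i hik => ?_
      obtain ⟨y, hy, hyv⟩ := hcon i
      rcases Finset.mem_insert.1 hy with rfl | hy
      · exact (hxM i hik).trans hyv
      · exact (hμle i y hy).trans_lt hyv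
    obtain ⟨y, hy, hyv⟩ := hcon k
    rcases Finset.mem_insert.1 hy with rfl | hy
    · exact absurd hle (not_le.2 hyv)
    · exact absurd (hle.trans (hkx.le.trans (hμle k y hy))) (not_le.2 hyv)
  have hatt : ∀ y ∈ d, ∃ i, μ i = y := by
    intro y hy
    obtain ⟨i, hi⟩ := hd y
    exact ⟨i, hu.injective i (le_antisymm (hμle i y hy) (hi _ (hμ i)))⟩
  obtain ⟨x₁, hx₁, hD₁, hk₁⟩ := hex i₁ fun y hy => by
    obtain ⟨i, hi⟩ := hatt y hy
    by_cases h : i = i₁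
    · exact ⟨i₂, hne.symm, by rw [← heq, ← h, hi]⟩
    · exact ⟨i, h, hi⟩
  obtain ⟨x₂, hx₂, hD₂, hk₂⟩ := hex i₂ fun y hy => by
    obtain ⟨i, hi⟩ := hatt y hy
    by_cases h : i = i₂
    · exact ⟨i₁, hne, by rw [heq, ← h, hi]⟩
    · exact ⟨i, h, hi⟩
  have hxne : x₁ ≠ x₂ := by
    rintro rfl
    obtain ⟨k, -, hk⟩ := hlow hx₁ hD₁
    exact hne (((hk _).1 hk₁).trans ((hk _).1 hk₂).symm)
  have hfil : (rooms.filter fun R => d ⊆ R) = {insert x₁ d, insert x₂ d} := by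
    ext R
    simp only [Finset.mem_filter, hrooms, Finset.mem_insert, Finset.mem_singleton]
    constructor
    · rintro ⟨⟨hR, hRc⟩, hdR⟩
      obtain ⟨x, hx, rfl⟩ := Finset.exists_eq_insert_iff.2 ⟨hdR, hcard.trans hRc.symm⟩
      obtain ⟨k, hk, hkk⟩ := hlow hx hR
      have hkx := (hkk k).2 rfl
      rcases hk with rfl | rfl
      · left
        rw [hu.injective k (le_antisymm (huniq k _ _ hx₁ hx hD₁ hR hk₁ hkx)
          (huniq k _ _ hx hx₁ hR hD₁ hkx hk₁))]
      · right
        rw [hu.injective k (le_antisymm (huniq k _ _ hx₂ hx hD₂ hR hk₂ hkx)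
          (huniq k _ _ hx hx₂ hR hD₂ hkx hk₂))]
    · rintro (rfl | rfl)
      · exact ⟨⟨hD₁, by rw [Finset.card_insert_of_notMem hx₁, hcard]⟩, Finset.subset_insert _ _⟩
      · exact ⟨⟨hD₂, by rw [Finset.card_insert_of_notMem hx₂, hcard]⟩, Finset.subset_insert _ _⟩
  rw [hfil, Finset.card_pair]
  intro h
  have : x₁ ∈ insert x₂ d := h ▸ Finset.mem_insert_self _ _
  rcases Finset.mem_insert.1 this with h | h
  · exact hxne h
  · exact hx₁ h

/-- The set of all slack points but one lies in exactly one dominant set of `|I|` points. -/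
lemma IsSlackRanking.card_insert_eq_one [Nonempty T] (hu : IsSlackRanking u) (i₀ : I)
    {rooms : Finset (Finset (T ⊕ I))}
    (hrooms : ∀ R, R ∈ rooms ↔ Dominant u R ∧ R.card = Fintype.card I) :
    (rooms.filter fun R => (Finset.univ.erase i₀).image Sum.inr ⊆ R).card = 1 := by
  classical
  set d : Finset (T ⊕ I) := (Finset.univ.erase i₀).image Sum.inr with hd
  have hcard : d.card + 1 = Fintype.card I := by
    rw [hd, Finset.card_image_of_injective _ Sum.inr_injective,
      Finset.card_erase_of_mem (Finset.mem_univ _), Finset.card_univ]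
    have := Fintype.card_pos_iff.2 ⟨i₀⟩
    omega
  have hmemd : ∀ i, Sum.inr i ∈ d ↔ i ≠ i₀ := by intro i; simp [hd]
  have hinl : ∀ t, Sum.inl t ∉ d := by intro t; simp [hd]
  -- The only point that can be added is the `i₀`-highest non-slack one: in every other ranking the
  -- slack point already present is lowest, so `t` can be dominated only in `i₀`.
  obtain ⟨t, -, ht⟩ := (Finset.univ : Finset T).exists_max_image (fun t => u i₀ (Sum.inl t))
    Finset.univ_nonempty
  have hdomt : Dominant u (insert (Sum.inl t) d) := by
    rintro (s | j)
    · refine ⟨i₀, fun x hx => ?_⟩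
      rcases Finset.mem_insert.1 hx with rfl | hx
      · exact ht s (Finset.mem_univ _)
      · rcases x with x | x
        · exact absurd hx (hinl x)
        · exact (hu.high _ _ _ ((hmemd x).1 hx).symm).le
    · refine ⟨j, fun x _ => ?_⟩
      by_cases h : x = Sum.inr j
      · rw [h]
      · exact (hu.low j x h).le
  refine Finset.card_eq_one.2 ⟨insert (Sum.inl t) d, ?_⟩
  ext R
  simp only [Finset.mem_filter, hrooms, Finset.mem_singleton]
  constructor
  · rintro ⟨⟨hR, hRc⟩, hdR⟩
    obtain ⟨x, hx, rfl⟩ := Finset.exists_eq_insert_iff.2 ⟨hdR, hcard.trans hRc.symm⟩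
    obtain ⟨i, hi⟩ := hR (Sum.inl t)
    have hii : i = i₀ := by
      by_contra h
      exact absurd (hi _ (Finset.mem_insert_of_mem ((hmemd i).2 h)))
        (not_le.2 (hu.low _ _ Sum.inl_ne_inr))
    subst hii
    have hix := hi x (Finset.mem_insert_self _ _)
    rcases x with s | j
    · rw [hu.injective i (le_antisymm hix (ht s (Finset.mem_univ _)))]
    · have : j = i := by by_contra h; exact hx ((hmemd j).2 h)
      subst this
      exact absurd hix (not_le.2 (hu.low _ _ Sum.inl_ne_inr))
  · rintro rfl
    exact ⟨⟨hdomt, by rw [Finset.card_insert_of_notMem (hinl t), hcard]⟩, Finset.subset_insert _ _⟩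

/-- If a set `R` with `|I|` points misses at least one colour, then it has an even number of subsets
with `|I| - 1` points whose colours are all those different from `i₀`. -/
lemma even_card_almost_colourful {V : Type*} [DecidableEq V] (c : V → I) (i₀ : I)
    {doors : Finset (Finset V)} {R : Finset V} (hR : R.card = Fintype.card I)
    (hdoors : ∀ d ⊆ R, d ∈ doors ↔ d.card + 1 = Fintype.card I ∧ d.image c = Finset.univ.erase i₀)
    (hc : R.image c ≠ Finset.univ) : Even (doors.filter fun d => d ⊆ R).card := by
  classical
  rcases (doors.filter fun d => d ⊆ R).eq_empty_or_nonempty with h | ⟨d, hd⟩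
  · simp [h]
  obtain ⟨hdd, hdR⟩ := Finset.mem_filter.1 hd
  have hdc := (hdoors d hdR).1 hdd
  have hRc : R.image c = Finset.univ.erase i₀ := by
    refine (Finset.eq_of_subset_of_card_le (hdc.2 ▸ Finset.image_subset_image hdR) ?_).symm
    rw [Finset.card_erase_of_mem (Finset.mem_univ _), Finset.card_univ]
    have := Finset.card_lt_univ_of_notMem
      (not_forall.1 fun h => hc (Finset.eq_univ_iff_forall.2 h)).choose_spec
    omega
  have hce : (Finset.univ.erase i₀).card + 1 = Fintype.card I := by
    rw [Finset.card_erase_of_mem (Finset.mem_univ _), Finset.card_univ]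
    have := Fintype.card_pos_iff.2 ⟨i₀⟩
    omega
  -- One colour occurs twice, at `x` and `y`. Removing either leaves a door; removing any other
  -- point leaves a repeated colour.
  obtain ⟨x, hx, y, hy, hxy, hcxy⟩ := Finset.exists_ne_map_eq_of_card_lt_of_maps_to
    (s := R) (t := Finset.univ.erase i₀) (by omega) (f := c)
    (fun z hz => hRc ▸ Finset.mem_image_of_mem c hz)
  have key : ∀ x ∈ R, ∀ y ∈ R, x ≠ y → c x = c y → R.erase x ∈ doors := by
    intro x hx y hy hxy hcxy
    refine (hdoors _ (Finset.erase_subset _ _)).2 ⟨by rw [Finset.card_erase_add_one hx, hR], ?_⟩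
    rw [← hRc]
    refine Finset.Subset.antisymm (Finset.image_subset_image (Finset.erase_subset _ _)) ?_
    intro i hi
    obtain ⟨z, hz, rfl⟩ := Finset.mem_image.1 hi
    by_cases hzx : z = x
    · rw [hzx, hcxy]
      exact Finset.mem_image_of_mem c (Finset.mem_erase.2 ⟨hxy.symm, hy⟩)
    · exact Finset.mem_image_of_mem c (Finset.mem_erase.2 ⟨hzx, hz⟩)
  have hfil : (doors.filter fun d => d ⊆ R) = {R.erase x, R.erase y} := by
    ext e
    simp only [Finset.mem_filter, Finset.mem_insert, Finset.mem_singleton]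
    constructor
    · rintro ⟨he, heR⟩
      obtain ⟨hec, hei⟩ := (hdoors e heR).1 he
      obtain ⟨z, hz, rfl⟩ := Finset.exists_eq_insert_iff.2 ⟨heR, hec.trans hR.symm⟩
      have hinj : Set.InjOn c e := Finset.card_image_iff.1 (by rw [hei]; omega)
      by_cases hzx : z = x
      · left; rw [← hzx, Finset.erase_insert hz]
      by_cases hzy : z = y
      · right; rw [← hzy, Finset.erase_insert hz]
      have h1 : x ∈ e := (Finset.mem_insert.1 hx).resolve_left (Ne.symm hzx)
      have h2 : y ∈ e := (Finset.mem_insert.1 hy).resolve_left (Ne.symm hzy)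
      exact absurd (hinj h1 h2 hcxy) hxy
    · rintro (rfl | rfl)
      · exact ⟨key x hx y hy hxy hcxy, Finset.erase_subset _ _⟩
      · exact ⟨key y hy x hx hxy.symm hcxy.symm, Finset.erase_subset _ _⟩
  rw [hfil, Finset.card_pair]
  · exact even_two
  · intro h
    have : x ∈ R.erase y := Finset.mem_erase.2 ⟨hxy, hx⟩
    rw [← h] at this
    exact Finset.notMem_erase _ _ this

/-- **Scarf's lemma** (combinatorial form): for every colouring that gives the slack points their
own colours there is a dominant set with `|I|` points that has all colours. -/
theorem IsSlackRanking.exists_colourful [Nonempty T] [Nonempty I] (hu : IsSlackRanking u)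
    (c : T ⊕ I → I) (hc : ∀ i, c (Sum.inr i) = i) :
    ∃ R, Dominant u R ∧ R.card = Fintype.card I ∧ R.image c = Finset.univ := by
  classical
  obtain ⟨i₀⟩ := ‹Nonempty I›
  by_contra! hcon
  set rooms : Finset (Finset (T ⊕ I)) :=
    Finset.univ.filter fun R => Dominant u R ∧ R.card = Fintype.card I with hrooms
  set doors : Finset (Finset (T ⊕ I)) := Finset.univ.filter fun d =>
    Dominant u d ∧ d.card + 1 = Fintype.card I ∧ d.image c = Finset.univ.erase i₀ with hdoors
  have hr : ∀ R, R ∈ rooms ↔ Dominant u R ∧ R.card = Fintype.card I := by simp [hrooms]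
  -- Count the pairs of a door contained in a room. Without a colourful room the count is even by
  -- rooms, but by doors it is odd: `d₀` lies in one room, every other door in two.
  have hsum := Finset.sum_card_bipartiteAbove_eq_sum_card_bipartiteBelow
    (s := doors) (t := rooms) (fun d R => d ⊆ R)
  simp only [Finset.bipartiteAbove, Finset.bipartiteBelow] at hsum
  have heven : Even (∑ R ∈ rooms, (doors.filter fun d => d ⊆ R).card) := by
    refine Finset.even_sum _ fun R hR => ?_
    obtain ⟨hRd, hRc⟩ := (hr R).1 hR
    refine even_card_almost_colourful c i₀ hRc (fun d hd => ?_) (hcon R hRd hRc)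
    simp [hdoors, hRd.mono hd]
  set d₀ : Finset (T ⊕ I) := (Finset.univ.erase i₀).image Sum.inr with hd₀
  have hone := hu.card_insert_eq_one i₀ hr
  have hd₀mem : d₀ ∈ doors := by
    obtain ⟨R, hR⟩ := Finset.card_pos.1 (by rw [hone]; exact one_pos)
    obtain ⟨hR, hsub⟩ := Finset.mem_filter.1 hR
    simp only [hdoors, Finset.mem_filter, Finset.mem_univ, true_and]
    refine ⟨((hr R).1 hR).1.mono hsub, ?_, ?_⟩
    · rw [hd₀, Finset.card_image_of_injective _ Sum.inr_injective,
        Finset.card_erase_add_one (Finset.mem_univ _), Finset.card_univ]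
    · rw [hd₀, Finset.image_image]
      ext i
      simp [hc]
  rw [← hsum, ← Finset.add_sum_erase _ _ hd₀mem, hone, Finset.sum_congr rfl (g := fun _ => 2)] at heven
  · simp only [Finset.sum_const, smul_eq_mul] at heven
    rw [Nat.even_iff] at heven
    omega
  · intro d hd
    obtain ⟨hne, hd⟩ := Finset.mem_erase.1 hd
    simp only [hdoors, Finset.mem_filter, Finset.mem_univ, true_and] at hd
    obtain ⟨hdom, hcard, himg⟩ := hd
    by_cases ht : ∃ t, Sum.inl t ∈ d
    · exact hu.card_insert_eq_two hdom hcard ht.choose_spec hr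
    · push Not at ht
      -- A door of slack points alone is determined by its colours, so it is `d₀`.
      refine absurd (Finset.eq_of_subset_of_card_le ?_ ?_) hne
      · intro x hx
        rcases x with t | i
        · exact absurd hx (ht t)
        · refine Finset.mem_image_of_mem _ ?_
          rw [← himg, ← hc i]
          exact Finset.mem_image_of_mem c hx
      · rw [hd₀, Finset.card_image_of_injective _ Sum.inr_injective,
          Finset.card_erase_of_mem (Finset.mem_univ _), Finset.card_univ]
        omega

end Scarf

/-! ### From Scarf's lemma to approximate equilibria on a simplex -/

section Simplex

variable {I : Type*} [Fintype I] [DecidableEq I]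

/-- Among the points of a set `s` of vectors with sum `m` that is dominant for the coordinates in
`C`, each coordinate varies by at most `|I|`, and those outside `C` are at most `|I|`. -/
lemma grid_bounds {m : ℕ} {s : Set (I → ℕ)} {C : Finset I} (hs : s.Nonempty)
    (hsum : ∀ t ∈ s, ∑ i, t i = m)
    (hdom : ∀ v : I → ℕ, ∑ i, v i = m → ∃ i ∈ C, ∀ t ∈ s, v i ≤ t i) {t : I → ℕ} (ht : t ∈ s) :
    (∀ i ∉ C, t i ≤ Fintype.card I) ∧ ∀ t' ∈ s, ∀ i, t i ≤ t' i + Fintype.card I := by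
  classical
  have hmin : ∀ i, ∃ t ∈ s, ∀ t' ∈ s, t i ≤ t' i := fun i => by
    obtain ⟨t, ht, h⟩ := WellFounded.has_min (measure fun t : I → ℕ => t i).wf s hs
    exact ⟨t, ht, fun t' ht' => not_lt.1 (h t' ht')⟩
  choose τ hτ hτle using hmin
  set a : I → ℕ := fun i => τ i i with ha
  -- Otherwise the vector with entries `a i + 1` on `C`, with the excess `r` put on `i₀`, has sum
  -- `m` and beats the minimum in every coordinate of `C`, against dominance. The remaining bounds
  -- compare this with the sum of `t`.
  have hC : m < ∑ i ∈ C, (a i + 1) := by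
    by_contra! hle
    obtain ⟨i₀, hi₀, -⟩ := hdom t (hsum t ht)
    set r := m - ∑ i ∈ C, (a i + 1) with hr
    obtain ⟨i, hi, hv⟩ := hdom
      (fun i => (if i ∈ C then a i + 1 else 0) + if i = i₀ then r else 0) (by
        rw [Finset.sum_add_distrib, Finset.sum_ite_mem, Finset.univ_inter]
        simp; omega)
    have := hv _ (hτ i)
    simp only [hi, if_true] at this
    change _ ≤ a i at this
    omega
  have hCn : C.card ≤ Fintype.card I := Finset.card_le_univ C
  have hC' : m < ∑ i ∈ C, a i + Fintype.card I := by
    rw [Finset.sum_add_distrib, Finset.sum_const, smul_eq_mul, mul_one] at hC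
    omega
  have h1 : ∀ t ∈ s, ∀ i ∉ C, t i ≤ Fintype.card I := by
    intro t ht i hi
    have h2 : ∑ j ∈ C, a j ≤ ∑ j ∈ C, t j := Finset.sum_le_sum fun j _ => hτle j t ht
    have h3 : ∑ j ∈ insert i C, t j ≤ ∑ j, t j :=
      Finset.sum_le_sum_of_subset (Finset.subset_univ _)
    rw [Finset.sum_insert hi, hsum t ht] at h3
    omega
  refine ⟨h1 t ht, fun t' ht' i => ?_⟩
  by_cases hi : i ∈ C
  · have h2 : ∑ j ∈ C.erase i, a j ≤ ∑ j ∈ C.erase i, t j :=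
      Finset.sum_le_sum fun j _ => hτle j t ht
    have h3 : ∑ j ∈ C, t j ≤ ∑ j, t j := Finset.sum_le_sum_of_subset (Finset.subset_univ _)
    rw [← Finset.add_sum_erase _ _ hi, hsum t ht] at h3
    rw [← Finset.add_sum_erase _ _ hi] at hC'
    have : a i ≤ t' i := hτle i t' ht'
    omega
  · have := h1 t ht i hi
    omega

/-- A Sperner-type lemma for the vectors of natural numbers with sum `m`: for every colouring by
the coordinates, some vector is close to vectors of all colours, except for colours that belong to
coordinates in which it is small. -/
theorem exists_near_colours [Nonempty I] (m : ℕ) (c : (I → ℕ) → I) :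
    ∃ t : I → ℕ, ∑ i, t i = m ∧ ∀ i, t i ≤ Fintype.card I ∨
      ∃ t' : I → ℕ, ∑ j, t' j = m ∧ c t' = i ∧
        ∀ j, t j ≤ t' j + Fintype.card I ∧ t' j ≤ t j + Fintype.card I := by
  classical
  let T := {t : I → ℕ // t ∈ Finset.piAntidiag (Finset.univ : Finset I) m}
  have hT : ∀ t : T, ∑ i, t.1 i = m := fun t => (Finset.mem_piAntidiag.1 t.2).1
  have mkT : ∀ t : I → ℕ, ∑ i, t i = m → t ∈ Finset.piAntidiag (Finset.univ : Finset I) m :=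
    fun t ht => Finset.mem_piAntidiag.2 ⟨ht, fun _ _ => Finset.mem_univ _⟩
  have : Nonempty T := by
    obtain ⟨i₀⟩ := ‹Nonempty I›
    exact ⟨⟨fun i => if i = i₀ then m else 0, mkT _ (by simp)⟩⟩
  have hTle : ∀ (t : T) i, t.1 i ≤ m := fun t i =>
    (Finset.single_le_sum (fun _ _ => Nat.zero_le _) (Finset.mem_univ i)).trans (hT t).le
  let e := Fintype.equivFin T
  let e' := Fintype.equivFin I
  set N := Fintype.card T with hN
  -- Grid points are ranked by their `i`-th coordinate, ties broken by the enumeration `e`; the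
  -- value 0 is kept for slack `i`, and the other slack points lie above the whole grid.
  let u : I → T ⊕ I → ℕ := fun i => Sum.elim (fun t => 1 + (t.1 i * N + e t))
    (fun j => if j = i then 0 else 1 + ((m + 1) * N + e' j))
  have hlt : ∀ (t : T) i, t.1 i * N + e t < (m + 1) * N := by
    intro t i
    calc t.1 i * N + e t < t.1 i * N + N := by have := (e t).2; omega
      _ = (t.1 i + 1) * N := by ring
      _ ≤ (m + 1) * N := Nat.mul_le_mul_right _ (Nat.succ_le_succ (hTle t i))
  have hle : ∀ (t t' : T) i, u i (Sum.inl t) ≤ u i (Sum.inl t') → t.1 i ≤ t'.1 i := by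
    intro t t' i h
    simp only [u, Sum.elim_inl] at h
    by_contra! hcon
    have h1 : (t'.1 i + 1) * N ≤ t.1 i * N := Nat.mul_le_mul_right _ hcon
    have h2 := (e t').2
    rw [add_mul] at h1
    omega
  have hu : IsSlackRanking u := by
    refine ⟨fun i => ?_, fun i v hv => ?_, fun i j t hij => ?_⟩
    · rintro (t | j) (t' | j') h
      · have h1 : t.1 i = t'.1 i := le_antisymm (hle _ _ _ h.le) (hle _ _ _ h.ge)
        simp only [u, Sum.elim_inl, h1] at h
        rw [e.injective (Fin.ext (by omega : (e t : ℕ) = e t'))]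
      · have := hlt t i
        simp only [u, Sum.elim_inl, Sum.elim_inr] at h
        split_ifs at h <;> omega
      · have := hlt t' i
        simp only [u, Sum.elim_inl, Sum.elim_inr] at h
        split_ifs at h <;> omega
      · simp only [u, Sum.elim_inr] at h
        split_ifs at h with h1 h2 h2
        · rw [h1, h2]
        · omega
        · omega
        · rw [e'.injective (Fin.ext (by omega : (e' j : ℕ) = e' j'))]
    · rcases v with t | j
      · simp [u]
      · have : j ≠ i := fun h => hv (h ▸ rfl)
        simp [u, this]
    · have := hlt t i
      simp only [u, Sum.elim_inl, Sum.elim_inr, hij.symm, if_false]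
      omega
  obtain ⟨R, hR, -, hRc⟩ := hu.exists_colourful (Sum.elim (fun t : T => c t.1) id) (fun _ => rfl)
  set s : Set (I → ℕ) := {t | ∃ h, Sum.inl (⟨t, h⟩ : T) ∈ R} with hs
  have hcol : ∀ i, Sum.inr i ∉ R → ∃ t ∈ s, c t = i := by
    intro i hi
    obtain ⟨x, hx, hxi⟩ := Finset.mem_image.1 (hRc ▸ Finset.mem_univ i)
    rcases x with t | j
    · exact ⟨t.1, ⟨t.2, hx⟩, hxi⟩
    · simp only [Sum.elim_inr, id] at hxi
      exact absurd (hxi ▸ hx) hi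
  -- A slack point in `R` is lowest in its own ranking, so no grid point is dominated there; only
  -- coordinates whose slack point is absent remain.
  have hdom : ∀ v : I → ℕ, ∑ i, v i = m →
      ∃ i ∈ Finset.univ.filter fun i => Sum.inr i ∉ R, ∀ t ∈ s, v i ≤ t i := by
    intro v hv
    obtain ⟨i, hi⟩ := hR (Sum.inl ⟨v, mkT v hv⟩)
    refine ⟨i, ?_, fun t ⟨ht, htR⟩ => hle ⟨v, mkT v hv⟩ ⟨t, ht⟩ i (hi _ htR)⟩
    simp only [Finset.mem_filter, Finset.mem_univ, true_and]
    exact fun h => absurd (hi _ h) (not_le.2 (hu.low _ _ Sum.inl_ne_inr))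
  have hne : s.Nonempty := by
    obtain ⟨i, hi, -⟩ := hdom _ (hT (Classical.arbitrary T))
    obtain ⟨t, ht, -⟩ := hcol i (Finset.mem_filter.1 hi).2
    exact ⟨t, ht⟩
  have hsum : ∀ t ∈ s, ∑ i, t i = m := fun t ⟨h, _⟩ => hT ⟨t, h⟩
  obtain ⟨t, ht⟩ := hne
  have hb := fun {t} (ht : t ∈ s) => grid_bounds ⟨t, ht⟩ hsum hdom ht
  refine ⟨t, hsum t ht, fun i => ?_⟩
  by_cases hi : Sum.inr i ∈ R
  · exact Or.inl ((hb ht).1 i (by simpa using hi))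
  · obtain ⟨t', ht', hc⟩ := hcol i hi
    exact Or.inr ⟨t', hsum t' ht', hc, fun j => ⟨(hb ht).2 t' ht' j, (hb ht').2 t ht j⟩⟩

/-- For a continuous vector field `h` on the standard simplex there is a point `y` at which no
coordinate of `h y` exceeds the average `∑ i, y i * h y i` by more than `η`. -/
theorem exists_approx_equilibrium [Nonempty I] {h : (I → ℝ) → I → ℝ}
    (hc : ContinuousOn h (stdSimplex ℝ I)) {η : ℝ} (hη : 0 < η) :
    ∃ y ∈ stdSimplex ℝ I, ∀ j, h y j ≤ ∑ i, y i * h y i + η := by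
  classical
  obtain ⟨B, hB⟩ := (isCompact_stdSimplex ℝ I).exists_bound_of_continuousOn hc
  have hB' : ∀ y ∈ stdSimplex ℝ I, ∀ i, |h y i| ≤ B := fun y hy i =>
    (norm_le_pi_norm (h y) i).trans (hB y hy)
  obtain ⟨d, hd, hdd⟩ := Metric.uniformContinuousOn_iff.1
    ((isCompact_stdSimplex ℝ I).uniformContinuousOn_of_continuous hc) (η / 3) (by positivity)
  set n : ℝ := (Fintype.card I : ℝ) with hn
  have hn0 : 0 < n := by rw [hn]; exact_mod_cast Fintype.card_pos
  have hB0 : 0 ≤ B := by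
    obtain ⟨i₀⟩ := ‹Nonempty I›
    exact (norm_nonneg _).trans (hB _ (single_mem_stdSimplex ℝ i₀))
  -- The first bound makes grid neighbours `d`-close; the second keeps the total loss from the `n`
  -- small coordinates below `η / 3`.
  obtain ⟨m, hm⟩ := exists_nat_gt (max (n / d) (n * n * (2 * B) * 3 / η))
  have hm1 := (le_max_left _ _).trans_lt hm
  have hm2 := (le_max_right _ _).trans_lt hm
  have hm0 : (0 : ℝ) < m := lt_of_le_of_lt (by positivity) hm1
  set pt : (I → ℕ) → I → ℝ := fun t i => t i / m with hpt
  have hptΔ : ∀ t : I → ℕ, ∑ i, t i = m → pt t ∈ stdSimplex ℝ I := by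
    intro t ht
    refine ⟨fun i => by positivity, ?_⟩
    rw [← Finset.sum_div, ← Nat.cast_sum, ht, div_self hm0.ne']
  have hmax : ∀ t : I → ℕ, ∃ i, ∀ j, h (pt t) j ≤ h (pt t) i := fun t => by
    obtain ⟨i, -, hi⟩ := Finset.univ.exists_max_image (h (pt t)) Finset.univ_nonempty
    exact ⟨i, fun j => hi j (Finset.mem_univ j)⟩
  choose c hcmax using hmax
  obtain ⟨t, ht, hnear⟩ := exists_near_colours m c
  refine ⟨pt t, hptΔ t ht, fun j => ?_⟩
  have hy := hptΔ t ht
  -- The colour is a coordinate where `h` is largest. Either `i` has weight at most `n / m`, or it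
  -- is largest at a nearby point and hence within `2 * η / 3` of largest here.
  have hterm : ∀ i, pt t i * h (pt t) j - pt t i * (2 * η / 3) - n / m * (2 * B) ≤
      pt t i * h (pt t) i := by
    intro i
    have hyi := hy.1 i
    rcases hnear i with hi | ⟨t', ht', rfl, hclose⟩
    · have h1 : pt t i ≤ n / m := by
        simp only [hpt, hn]
        gcongr
      have h2 : h (pt t) j - h (pt t) i ≤ 2 * B := by
        linarith [(abs_le.1 (hB' _ hy j)).2, (abs_le.1 (hB' _ hy i)).1]
      have h3 : pt t i * (h (pt t) j - h (pt t) i) ≤ n / m * (2 * B) :=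
        (mul_le_mul_of_nonneg_left h2 hyi).trans (mul_le_mul_of_nonneg_right h1 (by positivity))
      have h4 : 0 ≤ pt t i * (2 * η / 3) := by positivity
      linarith
    · have hdist : dist (pt t) (pt t') < d := by
        refine lt_of_le_of_lt ((dist_pi_le_iff (r := n / m) (by positivity)).2 fun k => ?_) ?_
        · rw [Real.dist_eq, ← sub_div, abs_div, abs_of_pos hm0]
          gcongr
          obtain ⟨h1, h2⟩ := hclose k
          have h1' : (t k : ℝ) ≤ t' k + n := by rw [hn]; exact_mod_cast h1
          have h2' : (t' k : ℝ) ≤ t k + n := by rw [hn]; exact_mod_cast h2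
          exact abs_le.2 ⟨by linarith, by linarith⟩
        · rwa [div_lt_iff₀ hm0, mul_comm, ← div_lt_iff₀ hd]
      have hdh := hdd _ hy _ (hptΔ t' ht') hdist
      have hk : ∀ k, |h (pt t) k - h (pt t') k| ≤ η / 3 := fun k =>
        (dist_le_pi_dist _ _ k).trans hdh.le
      have h1 := (abs_le.1 (hk j)).2
      have h2 := (abs_le.1 (hk (c t'))).1
      have h3 := hcmax t' j
      have h4 : h (pt t) j - 2 * η / 3 ≤ h (pt t) (c t') := by linarith
      have h5 := mul_le_mul_of_nonneg_left h4 hyi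
      have h6 : 0 ≤ n / m * (2 * B) := by positivity
      linarith
  have hsum := Finset.sum_le_sum fun i (_ : i ∈ Finset.univ) => hterm i
  rw [Finset.sum_sub_distrib, Finset.sum_sub_distrib, ← Finset.sum_mul, ← Finset.sum_mul, hy.2,
    Finset.sum_const, Finset.card_univ, nsmul_eq_mul, ← hn] at hsum
  have hlast : n * (n / m * (2 * B)) ≤ η / 3 := by
    rw [div_lt_iff₀ hη] at hm2
    rw [show n * (n / m * (2 * B)) = n * n * (2 * B) / m by ring, div_le_iff₀ hm0]
    linarith
  linarith

end Simplex

/-! ### The weak* topology on the Baire probability measures -/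

section WeakStar

open scoped CompactlySupported

variable {Ω : Type*} [TopologicalSpace Ω]

lemma baire_le_borel (Ω : Type*) [TopologicalSpace Ω] : baire Ω ≤ borel Ω := by
  let : MeasurableSpace Ω := borel Ω
  have : BorelSpace Ω := ⟨rfl⟩
  refine iSup_le fun f => ?_
  rw [← measurable_iff_comap_le]
  exact f.continuous.borel_measurable

lemma measurable_baire {f : Ω → ℝ} (hf : Continuous f) : @Measurable Ω ℝ (baire Ω) _ f := by
  rw [measurable_iff_comap_le, BorelSpace.measurable_eq (α := ℝ)]
  exact le_iSup (fun f : C(Ω, ℝ) => MeasurableSpace.comap f (borel ℝ)) ⟨f, hf⟩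

instance Prob.instIsProbabilityMeasure (p : Prob Ω) : IsProbabilityMeasure p.1 := p.2

lemma Prob.integrable [CompactSpace Ω] (p : Prob Ω) (f : C(Ω, ℝ)) : Integrable f p.1 :=
  Integrable.of_bound (measurable_baire f.continuous).aestronglyMeasurable ‖f‖
    (ae_of_all _ f.norm_coe_le_norm)

lemma Prob.isInducing_integral :
    IsInducing fun (p : Prob Ω) (f : C(Ω, ℝ)) => ∫ ω, f ω ∂p.1 := ⟨rfl⟩

lemma Prob.continuous_integral (f : C(Ω, ℝ)) : Continuous fun p : Prob Ω => ∫ ω, f ω ∂p.1 :=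
  (continuous_apply f).comp Prob.isInducing_integral.continuous

/-- Together with compactness this gives the normality needed for shrinking covers and for
partitions of unity. -/
instance Prob.instRegularSpace : RegularSpace (Prob Ω) :=
  Prob.isInducing_integral.regularSpace

/-- The normalized positive linear functionals on `C(Ω, ℝ)`. -/
def positiveFunctionals (Ω : Type*) [TopologicalSpace Ω] : Set (C(Ω, ℝ) → ℝ) :=
  {L | (∀ f g, L (f + g) = L f + L g) ∧ (∀ (c : ℝ) f, L (c • f) = c * L f) ∧
    (∀ f, 0 ≤ f → 0 ≤ L f) ∧ L 1 = 1}

lemma isClosed_positiveFunctionals : IsClosed (positiveFunctionals Ω) := by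
  simp only [positiveFunctionals, ofPred_and, ofPred_forall]
  refine ((isClosed_iInter fun f => isClosed_iInter fun g => ?_).inter
    ((isClosed_iInter fun c => isClosed_iInter fun f => ?_).inter
    ((isClosed_iInter fun f => isClosed_iInter fun _ => ?_).inter ?_)))
  · exact isClosed_eq (by fun_prop) (by fun_prop)
  · exact isClosed_eq (by fun_prop) (by fun_prop)
  · exact isClosed_le (by fun_prop) (by fun_prop)
  · exact isClosed_eq (by fun_prop) (by fun_prop)

lemma positiveFunctionals_mono {L : C(Ω, ℝ) → ℝ} (hL : L ∈ positiveFunctionals Ω) {f g : C(Ω, ℝ)}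
    (h : f ≤ g) : L f ≤ L g := by
  have h1 := hL.2.2.1 (g - f) (sub_nonneg.2 h)
  have h2 := hL.1 (g - f) f
  rw [sub_add_cancel] at h2
  linarith

/-- Positivity and normalization force |L f| ≤ ‖f‖, so Tychonoff's theorem applies, as in
Banach–Alaoglu. -/
lemma isCompact_positiveFunctionals [CompactSpace Ω] : IsCompact (positiveFunctionals Ω) := by
  refine (isCompact_univ_pi fun f : C(Ω, ℝ) => isCompact_Icc (a := -‖f‖) (b := ‖f‖)).of_isClosed_subset
    isClosed_positiveFunctionals fun L hL f _ => ?_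
  have h1 : ∀ c : ℝ, L (c • 1) = c := fun c => by rw [hL.2.1, hL.2.2.2, mul_one]
  constructor
  · rw [← h1 (-‖f‖)]
    refine positiveFunctionals_mono hL fun ω => ?_
    simpa using (abs_le.1 (f.norm_coe_le_norm ω)).1
  · rw [← h1 ‖f‖]
    refine positiveFunctionals_mono hL fun ω => ?_
    simpa using (abs_le.1 (f.norm_coe_le_norm ω)).2

lemma Prob.integral_mem_positiveFunctionals [CompactSpace Ω] (p : Prob Ω) :
    (fun f : C(Ω, ℝ) => ∫ ω, f ω ∂p.1) ∈ positiveFunctionals Ω := by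
  refine ⟨fun f g => ?_, fun c f => ?_, fun f hf => integral_nonneg hf, ?_⟩
  · exact integral_add (p.integrable f) (p.integrable g)
  · exact integral_const_mul c _
  · simp

/-- The **Riesz–Markov–Kakutani theorem** for measures on the Baire σ-algebra. -/
lemma exists_prob_integral_eq [CompactSpace Ω] [T2Space Ω] {L : C(Ω, ℝ) → ℝ}
    (hL : L ∈ positiveFunctionals Ω) : ∃ p : Prob Ω, ∀ f : C(Ω, ℝ), ∫ ω, f ω ∂p.1 = L f := by
  let : MeasurableSpace Ω := borel Ω
  have : BorelSpace Ω := ⟨rfl⟩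
  let Λ : C_c(Ω, ℝ) →ₚ[ℝ] ℝ :=
    { toFun := fun g => L g.toContinuousMap
      map_add' := fun f g => hL.1 f.toContinuousMap g.toContinuousMap
      map_smul' := fun c f => hL.2.1 c f.toContinuousMap
      monotone' := fun f g h => positiveFunctionals_mono hL (f := f.toContinuousMap)
        (g := g.toContinuousMap) fun ω => h ω }
  set μ := RealRMK.rieszMeasure Λ with hμ
  have hint : ∀ f : C(Ω, ℝ), ∫ ω, f ω ∂μ = L f := fun f =>
    RealRMK.integral_rieszMeasure Λ ⟨f, HasCompactSupport.of_compactSpace _⟩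
  have hμ1 : μ univ = 1 := by
    have h1 := hint 1
    rw [hL.2.2.2] at h1
    simp only [ContinuousMap.one_apply, integral_const, smul_eq_mul, mul_one] at h1
    exact (ENNReal.toReal_eq_one_iff _).1 h1
  -- Restricting the Borel measure to the Baire σ-algebra does not change integrals of continuous
  -- functions.
  refine ⟨⟨μ.trim (baire_le_borel Ω), ⟨?_⟩⟩, fun f => ?_⟩
  · rw [trim_measurableSet_eq _ MeasurableSet.univ, hμ1]
  · rw [← hint f]
    exact (integral_trim (baire_le_borel Ω)
      (measurable_baire f.continuous).stronglyMeasurable).symm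

/-- By Riesz–Markov–Kakutani, the map that induces the topology has exactly the compact set
`positiveFunctionals Ω` as its range. -/
instance Prob.instCompactSpace [CompactSpace Ω] [T2Space Ω] : CompactSpace (Prob Ω) := by
  refine ⟨Prob.isInducing_integral.isCompact_iff.2 ?_⟩
  convert! isCompact_positiveFunctionals (Ω := Ω)
  ext L
  constructor
  · rintro ⟨p, -, rfl⟩
    exact p.integral_mem_positiveFunctionals
  · intro hL
    obtain ⟨p, hp⟩ := exists_prob_integral_eq hL
    exact ⟨p, mem_univ _, funext hp⟩

/-- The mixture of point masses with given weights. -/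
lemma exists_prob_integral_eq_sum [CompactSpace Ω] [T2Space Ω] {J : Type*} [Fintype J] (ω : J → Ω)
    {y : J → ℝ} (hy : y ∈ stdSimplex ℝ J) :
    ∃ p : Prob Ω, ∀ f : C(Ω, ℝ), ∫ ω, f ω ∂p.1 = ∑ j, y j * f (ω j) := by
  refine exists_prob_integral_eq (L := fun f => ∑ j, y j * f (ω j)) ⟨fun f g => ?_, fun c f => ?_,
    fun f hf => Finset.sum_nonneg fun j _ => mul_nonneg (hy.1 j) (hf _), by simpa using hy.2⟩
  · simp [mul_add, Finset.sum_add_distrib]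
  · simp only [ContinuousMap.smul_apply, smul_eq_mul, Finset.mul_sum]
    exact Finset.sum_congr rfl fun j _ => by ring

lemma Prob.nonempty [CompactSpace Ω] [T2Space Ω] [Nonempty Ω] : Nonempty (Prob Ω) := by
  obtain ⟨p, -⟩ := exists_prob_integral_eq_sum (fun _ : Unit => Classical.arbitrary Ω)
    (single_mem_stdSimplex ℝ ())
  exact ⟨p⟩

end WeakStar

/-- A barycentric refinement of an open cover, indexed by points. -/
lemma exists_barycentric_refinement {X : Type*} [TopologicalSpace X] [CompactSpace X]
    [NormalSpace X] {𝒜 : Set (Set X)} (hopen : ∀ U ∈ 𝒜, IsOpen U) (hcover : ⋃₀ 𝒜 = univ) :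
    ∃ N : X → Set X, (∀ p, IsOpen (N p) ∧ p ∈ N p) ∧ ∀ q, ∃ U ∈ 𝒜, ∀ p, q ∈ N p → p ∈ U := by
  obtain ⟨t, ht⟩ := isCompact_univ.elim_finite_subcover (fun U : 𝒜 => (U : Set X))
    (fun U => hopen U U.2) (by rw [← sUnion_eq_iUnion, hcover])
  obtain ⟨K, hKcover, hKclosed, hKsub⟩ := exists_iUnion_eq_closed_subset
    (u := fun U : t => (U.1 : Set X)) (fun U => hopen U.1 U.1.2) (fun _ => toFinite _) (by
      refine eq_univ_of_univ_subset (ht.trans ?_)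
      simp only [iUnion_subset_iff]
      exact fun U hU => subset_iUnion (fun U : t => (U.1 : Set X)) ⟨U, hU⟩)
  -- `N p` avoids each of the finitely many closed sets `K U` that miss `p`. If `q ∈ K U`, every `p`
  -- with `q ∈ N p` therefore lies in `K U ⊆ U`.
  refine ⟨fun p => ⋂ U, {x | x ∈ K U → p ∈ K U}, fun p => ⟨?_, ?_⟩, fun q => ?_⟩
  · refine isOpen_iInter_of_finite fun U => ?_
    by_cases h : p ∈ K U
    · simp [h]
    · have : {x | x ∈ K U → p ∈ K U} = (K U)ᶜ := by ext; simp [h]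
      rw [this]
      exact (hKclosed U).isOpen_compl
  · simp
  · obtain ⟨U, hU⟩ := mem_iUnion.1 (hKcover ▸ mem_univ q)
    exact ⟨U.1, U.1.2, fun p hp => hKsub U (mem_iInter.1 hp U hU)⟩

/-! ### Reducing the support to at most |Ω| points -/

section Support

/-- If more than `|Ω|` points carry positive weights under which the averages of `s ω` are at most
`δ` for all `ω`, then the weights can be changed so that one of them vanishes. -/
lemma exists_weights_vanishing {X Ω : Type*} [Fintype Ω] [Nonempty Ω] {D : Finset X} {w : X → ℝ}
    (hw : ∀ p ∈ D, 0 < w p) (hsum : ∑ p ∈ D, w p = 1) {s : Ω → X → ℝ} {δ : ℝ}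
    (hs : ∀ ω, ∑ p ∈ D, w p * s ω p ≤ δ) (hcard : Fintype.card Ω < D.card) :
    ∃ w' : X → ℝ, (∀ p ∈ D, 0 ≤ w' p) ∧ ∑ p ∈ D, w' p = 1 ∧
      (∀ ω, ∑ p ∈ D, w' p * s ω p ≤ δ) ∧ ∃ p ∈ D, w' p = 0 := by
  classical
  obtain ⟨ω₀⟩ := ‹Nonempty Ω›
  -- A kernel vector has total zero (row `ω₀`) and changes the averages of all `s ω` by one common
  -- amount, made nonpositive by a choice of sign. Allowing averages to drop is what gives |Ω|
  -- instead of Carathéodory's |Ω| + 1.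
  let L : (D → ℝ) →ₗ[ℝ] Ω → ℝ := LinearMap.pi fun ω =>
    ∑ p : D, (if ω = ω₀ then (1 : ℝ) else s ω p - s ω₀ p) • LinearMap.proj p
  have hLapp : ∀ d ω, L d ω = ∑ p : D, (if ω = ω₀ then (1 : ℝ) else s ω p - s ω₀ p) * d p := by
    intro d ω
    simp only [L, LinearMap.pi_apply, LinearMap.sum_apply, LinearMap.smul_apply,
      LinearMap.proj_apply, smul_eq_mul]
  have hker : LinearMap.ker L ≠ ⊥ := LinearMap.ker_ne_bot_of_finrank_lt (by simpa using hcard)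
  obtain ⟨d₀, hd₀, hd₀ne⟩ := (Submodule.ne_bot_iff _).1 hker
  obtain ⟨d, hd, hdne, hdle⟩ : ∃ d ∈ LinearMap.ker L, d ≠ 0 ∧ ∑ p : D, d p * s ω₀ p ≤ 0 := by
    rcases le_total (∑ p : D, d₀ p * s ω₀ p) 0 with h | h
    · exact ⟨d₀, hd₀, hd₀ne, h⟩
    · exact ⟨-d₀, Submodule.neg_mem _ hd₀, neg_ne_zero.2 hd₀ne, by simpa using h⟩
  have hd1 : ∑ p : D, d p = 0 := by
    have := congrFun (LinearMap.mem_ker.1 hd) ω₀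
    simpa [hLapp] using this
  have hd2 : ∀ ω, ∑ p : D, d p * s ω p ≤ 0 := by
    intro ω
    by_cases h : ω = ω₀
    · rwa [h]
    · have := congrFun (LinearMap.mem_ker.1 hd) ω
      rw [hLapp] at this
      simp only [h, if_false, sub_mul, Finset.sum_sub_distrib, Pi.zero_apply, sub_eq_zero] at this
      calc ∑ p : D, d p * s ω p = ∑ p : D, s ω p * d p :=
            Finset.sum_congr rfl fun p _ => mul_comm _ _
        _ = ∑ p : D, d p * s ω₀ p := by rw [this]; exact Finset.sum_congr rfl fun p _ => mul_comm _ _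
        _ ≤ 0 := hdle
  obtain ⟨p₁, hp₁⟩ : ∃ p, d p < 0 := by
    by_contra! hcon
    exact hdne (funext fun p =>
      (Finset.sum_eq_zero_iff_of_nonneg fun p _ => hcon p).1 hd1 p (Finset.mem_univ p))
  -- `p₀` is the first weight to reach zero when moving along `d`.
  obtain ⟨p₀, hp₀, hmin⟩ := (Finset.univ.filter fun p => d p < 0).exists_min_image
    (fun p => w p / -d p) ⟨p₁, by simpa using hp₁⟩
  simp only [Finset.mem_filter, Finset.mem_univ, true_and] at hp₀ hmin
  set r := w p₀ / -d p₀ with hr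
  have hr0 : 0 < r := div_pos (hw _ p₀.2) (neg_pos.2 hp₀)
  let w' : X → ℝ := fun p => w p + r * if h : p ∈ D then d ⟨p, h⟩ else 0
  have hw' : ∀ p : D, w' p = w p + r * d p := fun p => by simp [w']
  have hsumD : ∀ f : X → ℝ, ∑ p ∈ D, f p = ∑ p : D, f p := fun f => (Finset.sum_coe_sort D f).symm
  refine ⟨w', fun p hp => ?_, ?_, fun ω => ?_, p₀, p₀.2, ?_⟩
  · have := hw' ⟨p, hp⟩
    rw [this]
    rcases lt_or_ge (d ⟨p, hp⟩) 0 with h | h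
    · have h1 := hmin _ h
      rw [le_div_iff₀ (neg_pos.2 h)] at h1
      linarith
    · exact add_nonneg (hw p hp).le (mul_nonneg hr0.le h)
  · rw [hsumD]
    simp only [hw', Finset.sum_add_distrib, ← Finset.mul_sum, hd1, mul_zero, add_zero]
    rw [← hsumD, hsum]
  · rw [hsumD]
    simp only [hw', add_mul, Finset.sum_add_distrib, mul_assoc, ← Finset.mul_sum]
    rw [← hsumD fun p => w p * s ω p]
    linarith [hs ω, mul_nonpos_of_nonneg_of_nonpos hr0.le (hd2 ω)]
  · rw [hw', hr]
    have : d p₀ ≠ 0 := hp₀.ne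
    field_simp
    ring

variable {Ω : Type*} [TopologicalSpace Ω]

lemma FinProb.sum_weights (P : FinProb Ω) : ∑ p ∈ P.D, P.weights p = 1 := P.total

lemma FinProb.weights_pos (P : FinProb Ω) {p : Prob Ω} (hp : p ∈ P.D) : 0 < P.weights p :=
  lt_of_le_of_ne (P.nonneg p) (Ne.symm (Finsupp.mem_support_iff.1 hp))

/-- The randomized forecast with given weights on a finite set. -/
lemma FinProb.exists_of_weights {D : Finset (Prob Ω)} {w : Prob Ω → ℝ} (hw : ∀ p ∈ D, 0 ≤ w p)
    (hsum : ∑ p ∈ D, w p = 1) :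
    ∃ P : FinProb Ω, (∀ p, p ∈ P.D ↔ p ∈ D ∧ w p ≠ 0) ∧
      ∀ f, P.integral f = ∑ p ∈ D, w p * f p := by
  classical
  let W : Prob Ω →₀ ℝ := Finsupp.onFinset D (fun p => if p ∈ D then w p else 0) (by
    intro p hp; by_contra h; simp [h] at hp)
  have hWs : W.support ⊆ D := Finsupp.support_onFinset_subset
  have hW : ∀ p ∈ D, W p = w p := fun p hp => by simp [W, hp]
  refine ⟨⟨W, fun p => ?_, ?_⟩, fun p => ?_, fun f => ?_⟩
  · by_cases h : p ∈ D
    · simpa [hW p h] using hw p h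
    · simp [W, h]
  · rw [Finsupp.sum_of_support_subset _ hWs _ (by simp), Finset.sum_congr rfl hW, hsum]
  · by_cases h : p ∈ D
    · simp [FinProb.D, hW p h, h]
    · simp [FinProb.D, W, h]
  · change ∑ p ∈ W.support, W p * f p = _
    rw [Finset.sum_subset hWs fun p _ hp => by rw [Finsupp.notMem_support_iff.1 hp, zero_mul]]
    exact Finset.sum_congr rfl fun p hp => by rw [hW p hp]

/-- The support of a randomized forecast can be reduced to at most `|Ω|` points. -/
lemma FinProb.exists_card_le [Nonempty Ω] {S : Ω → Prob Ω → ℝ} {δ : ℝ} (P : FinProb Ω)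
    (hP : ∀ ω, P.integral (S ω) ≤ δ) :
    ∃ Q : FinProb Ω, Q.D ⊆ P.D ∧ (∀ ω, Q.integral (S ω) ≤ δ) ∧
      (Q.D.card : ℕ∞) ≤ ENat.card Ω := by
  classical
  cases finite_or_infinite Ω
  swap
  · exact ⟨P, Finset.Subset.refl _, hP, by simp⟩
  have := Fintype.ofFinite Ω
  obtain ⟨Q, ⟨hQD, hQ⟩, hmin⟩ := WellFounded.has_min (measure fun Q : FinProb Ω => Q.D.card).wf
    {Q | Q.D ⊆ P.D ∧ ∀ ω, Q.integral (S ω) ≤ δ} ⟨P, Finset.Subset.refl _, hP⟩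
  refine ⟨Q, hQD, hQ, ?_⟩
  rw [ENat.card_eq_coe_fintype_card, Nat.cast_le]
  by_contra! hcard
  obtain ⟨w, hw, hsum, hs, p, hp, hwp⟩ :=
    exists_weights_vanishing (fun p hp => Q.weights_pos hp) Q.sum_weights hQ hcard
  obtain ⟨Q', hQ'D, hQ'⟩ := FinProb.exists_of_weights hw hsum
  have hsub : Q'.D ⊆ Q.D := fun x hx => ((hQ'D x).1 hx).1
  refine hmin Q' ⟨hsub.trans hQD, fun ω => (hQ' _).trans_le (hs ω)⟩ ?_
  exact Finset.card_lt_card ⟨hsub, fun h => ((hQ'D p).1 (h hp)).2 hwp⟩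

end Support

/-! ### Minimax and the randomized forecast -/

section Forecast

variable {Ω : Type*} [TopologicalSpace Ω]

/-- A strongly upper semicontinuous function that is bounded below can be approximated from above
by continuous functions in mean. -/
lemma StronglyUpperSemicontinuous.exists_continuous_ge {S : Ω → ℝ}
    (hS : StronglyUpperSemicontinuous S) {b : ℝ} (hb : ∀ ω, b ≤ S ω) (p : Prob Ω) {c : ℝ}
    (hc : ∫ ω, S ω ∂p.1 < c) : ∃ g : C(Ω, ℝ), (∀ ω, S ω ≤ g ω) ∧ ∫ ω, g ω ∂p.1 < c := by
  obtain ⟨g, hg, hbdd, hanti, hlim⟩ := hS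
  have hant : ∀ ω, Antitone fun k => g k ω := fun ω => antitone_nat_of_succ_le fun k => hanti k ω
  have hge : ∀ k ω, S ω ≤ g k ω := fun k ω => (hant ω).le_of_tendsto (hlim ω) k
  obtain ⟨B, hB⟩ := hbdd 0
  have hB' : ∀ k ω, g k ω ≤ B := fun k ω => (hant ω (Nat.zero_le k)).trans (hB ⟨ω, rfl⟩)
  have htend : Tendsto (fun k => ∫ ω, g k ω ∂p.1) atTop (𝓝 (∫ ω, S ω ∂p.1)) := by
    refine tendsto_integral_of_dominated_convergence (fun _ => max |b| |B|)
      (fun k => (measurable_baire (hg k)).aestronglyMeasurable) (integrable_const _)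
      (fun k => ae_of_all _ fun ω => ?_) (ae_of_all _ hlim)
    rw [Real.norm_eq_abs]
    exact abs_le_max_abs_abs ((hb ω).trans (hge k ω)) (hB' k ω)
  obtain ⟨k, hk⟩ := (htend.eventually (gt_mem_nhds hc)).exists
  exact ⟨⟨g k, hg k⟩, hge k, hk⟩

variable [CompactSpace Ω] [T2Space Ω] [Nonempty Ω]

/-- If the continuous function `H q` has `q`-expectation at most `δ` for every `q`, then for any
finitely many points some `H q` is at most `2 * δ` at all of them. -/
lemma exists_forecast_finite {H : Prob Ω → C(Ω, ℝ)} (hH : ∀ ω, Continuous fun q => H q ω) {δ : ℝ}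
    (hδ : 0 < δ) (hint : ∀ q, ∫ ω, H q ω ∂q.1 ≤ δ) {J : Type*} [Fintype J] [Nonempty J]
    (ω : J → Ω) : ∃ q, ∀ j, H q (ω j) ≤ 2 * δ := by
  classical
  have : Nonempty (Prob Ω) := Prob.nonempty
  have hmix : ∀ y : J → ℝ, ∃ q : Prob Ω, y ∈ stdSimplex ℝ J →
      ∀ f : C(Ω, ℝ), ∫ ω, f ω ∂q.1 = ∑ j, y j * f (ω j) := by
    intro y
    by_cases hy : y ∈ stdSimplex ℝ J
    · obtain ⟨q, hq⟩ := exists_prob_integral_eq_sum ω hy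
      exact ⟨q, fun _ => hq⟩
    · exact ⟨Classical.arbitrary _, fun h => absurd h hy⟩
  choose q hq using hmix
  have hqc : ContinuousOn q (stdSimplex ℝ J) := by
    rw [Prob.isInducing_integral.continuousOn_iff]
    refine continuousOn_pi.2 fun f => ?_
    refine ContinuousOn.congr (f := fun y => ∑ j, y j * f (ω j)) (by fun_prop) fun y hy => ?_
    exact hq y hy f
  -- The average in the equilibrium inequality is the `q y`-integral of `H (q y)`, at most `δ`; the
  -- tolerance is the second `δ`.
  obtain ⟨y, hy, hyj⟩ := exists_approx_equilibrium (h := fun y j => H (q y) (ω j))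
    (continuousOn_pi.2 fun j => (hH (ω j)).comp_continuousOn hqc) hδ
  refine ⟨q y, fun j => (hyj j).trans ?_⟩
  have := hint (q y)
  rw [hq y hy] at this
  linarith

/-- A continuous **Ky Fan** type minimax theorem for forecasts. -/
lemma exists_forecast {H : Prob Ω → C(Ω, ℝ)} (hH : ∀ ω, Continuous fun q => H q ω) {δ : ℝ}
    (hδ : 0 < δ) (hint : ∀ q, ∫ ω, H q ω ∂q.1 ≤ δ) : ∃ q, ∀ ω, H q ω ≤ 2 * δ := by
  classical
  obtain ⟨q, hq⟩ := CompactSpace.iInter_nonempty (t := fun ω : Ω => {q | H q ω ≤ 2 * δ})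
    (fun ω => isClosed_le (hH ω) continuous_const) (fun s => by
      -- An extra outcome is inserted because the finite version needs a nonempty index set.
      have : Nonempty (insert (Classical.arbitrary Ω) s : Finset Ω) :=
        ⟨⟨_, Finset.mem_insert_self _ _⟩⟩
      obtain ⟨q, hq⟩ := exists_forecast_finite hH hδ hint
        (J := (insert (Classical.arbitrary Ω) s : Finset Ω)) (fun j => j.1)
      exact ⟨q, mem_iInter₂.2 fun ω hω => hq ⟨ω, Finset.mem_insert_of_mem hω⟩⟩)
  exact ⟨q, fun ω => mem_iInter.1 hq ω⟩

/-- Against every move of Sceptic there is a randomized forecast, concentrated on a small set with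
at most `|Ω|` points, that makes his expected gain smaller than `δ` whatever the outcome. -/
theorem exists_randomized_forecast {𝒜 : Set (Set (Prob Ω))} (hopen : ∀ U ∈ 𝒜, IsOpen U)
    (hcover : ⋃₀ 𝒜 = univ) {S : Ω → Prob Ω → ℝ}
    (husc : ∀ p, StronglyUpperSemicontinuous fun ω => S ω p) (hint : ∀ p, ∫ ω, S ω p ∂p.1 ≤ 0)
    {b : ℝ} (hb : ∀ ω p, b ≤ S ω p) {δ : ℝ} (hδ : 0 < δ) :
    ∃ P : FinProb Ω, (∃ U ∈ 𝒜, (↑P.D : Set (Prob Ω)) ⊆ U) ∧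
      (P.D.card : ℕ∞) ≤ ENat.card Ω ∧ ∀ ω, P.integral (S ω) ≤ δ := by
  classical
  obtain ⟨N, hN, hNbar⟩ := exists_barycentric_refinement hopen hcover
  have hg := fun p => (husc p).exists_continuous_ge (fun ω => hb ω p) p
    ((hint p).trans_lt (half_pos hδ))
  choose g hgS hgint using hg
  let O : Prob Ω → Set (Prob Ω) := fun p => {q | ∫ ω, g p ω ∂q.1 < δ / 2} ∩ N p
  have hO : ∀ p, IsOpen (O p) := fun p =>
    (isOpen_lt (Prob.continuous_integral (g p)) continuous_const).inter (hN p).1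
  obtain ⟨t, ht⟩ := isCompact_univ.elim_finite_subcover O hO
    fun p _ => mem_iUnion.2 ⟨p, hgint p, (hN p).2⟩
  obtain ⟨φ, hφ⟩ := PartitionOfUnity.exists_isSubordinate_of_locallyFinite isClosed_univ (fun p : t => O p)
    (fun p => hO p) (locallyFinite_of_finite _) (ht.trans (by
      simp only [iUnion_subset_iff]
      exact fun p hp => subset_iUnion (fun p : t => O p) ⟨p, hp⟩))
  have hφO : ∀ (p : t) q, φ p q ≠ 0 → q ∈ O p := fun p q h => hφ p (subset_tsupport _ h)
  have hφsum : ∀ q, ∑ p, φ p q = 1 := fun q => by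
    rw [← finsum_eq_sum_of_fintype]; exact φ.sum_eq_one (mem_univ q)
  let H : Prob Ω → C(Ω, ℝ) := fun q => ∑ p : t, φ p q • g p
  have hHapp : ∀ q ω, H q ω = ∑ p : t, φ p q * g p ω := fun q ω => by
    simp [H, ContinuousMap.sum_apply]
  -- Only those `g p` with `q ∈ O p` enter `H q`, and each has `q`-integral below `δ / 2`; the
  -- factor 2 of the minimax theorem brings this to `δ`.
  obtain ⟨q, hq⟩ := exists_forecast (H := H) (fun ω => by
      simp only [hHapp]; fun_prop) (half_pos hδ) (fun q => by
      simp only [hHapp]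
      rw [integral_finsetSum _ fun (p : t) _ => (q.integrable (g p.1)).const_mul (φ p q)]
      simp only [integral_const_mul]
      calc ∑ p : t, φ p q * ∫ ω, g p ω ∂q.1 ≤ ∑ p : t, φ p q * (δ / 2) := by
            refine Finset.sum_le_sum fun p _ => ?_
            by_cases h : φ p q = 0
            · simp [h]
            · exact mul_le_mul_of_nonneg_left (hφO p q h).1.le (φ.nonneg p q)
        _ = δ / 2 := by rw [← Finset.sum_mul, hφsum, one_mul])
  let w : Prob Ω → ℝ := fun p => if h : p ∈ t then φ ⟨p, h⟩ q else 0
  have hw : ∀ p : t, w p = φ p q := fun p => by simp [w]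
  have hsumt : ∀ f : Prob Ω → ℝ, ∑ p ∈ t, f p = ∑ p : t, f p := fun f =>
    (Finset.sum_coe_sort t f).symm
  obtain ⟨P, hPD, hPint⟩ := FinProb.exists_of_weights (D := t) (w := w)
    (fun p hp => by rw [hw ⟨p, hp⟩]; exact φ.nonneg _ _) (by rw [hsumt]; simp only [hw, hφsum])
  obtain ⟨Q, hQD, hQint, hQcard⟩ := P.exists_card_le (S := S) (δ := δ) fun ω => by
    rw [hPint, hsumt]
    simp only [hw]
    calc ∑ p : t, φ p q * S ω p ≤ ∑ p : t, φ p q * g p ω :=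
          Finset.sum_le_sum fun p _ => mul_le_mul_of_nonneg_left (hgS p ω) (φ.nonneg p q)
      _ ≤ 2 * (δ / 2) := by rw [← hHapp]; exact hq ω
      _ = δ := by ring
  obtain ⟨U, hU, hUq⟩ := hNbar q
  refine ⟨Q, ⟨U, hU, fun p hp => ?_⟩, hQcard, hQint⟩
  obtain ⟨hpt, hwp⟩ := (hPD p).1 (hQD hp)
  rw [hw ⟨p, hpt⟩] at hwp
  exact hUq p (hφO _ _ hwp).2

end Forecast

/-! ### The strategy and its capital -/

section Strategy

variable {Ω : Type*} [TopologicalSpace Ω]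

lemma FinProb.integral_sub_div (P : FinProb Ω) (f : Prob Ω → ℝ) (c d : ℝ) :
    P.integral (fun p => (f p - c) / d) = (P.integral f - c) / d := by
  simp only [FinProb.integral, mul_div_assoc', mul_sub, ← Finset.sum_div, Finset.sum_sub_distrib,
    ← Finset.sum_mul, P.sum_weights, one_mul]

/-- A randomized forecast that is good against Sceptic's move `S`, if there is any. -/
noncomputable def goodForecast [Nonempty (FinProb Ω)] (𝒜 : Set (Set (Prob Ω))) (δ : ℝ)
    (S : Ω → Prob Ω → ℝ) : FinProb Ω :=
  Classical.epsilon fun P => (∃ U ∈ 𝒜, (↑P.D : Set (Prob Ω)) ⊆ U) ∧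
    (P.D.card : ℕ∞) ≤ ENat.card Ω ∧ ∀ ω, P.integral (S ω) ≤ δ

/-- Forecaster plays good forecasts, and bets so that his capital times `1 + ε` exceeds Sceptic's
capital by `ε / 2 ^ n` after `n` rounds. -/
noncomputable def goodStrategy [Nonempty (FinProb Ω)] (ε : ℝ) (𝒜 : ℕ → Set (Set (Prob Ω))) :
    ForecasterStrategy Ω where
  forecast n _ S := goodForecast (𝒜 n) (ε / 2 ^ (n + 1)) S
  bet n _ S ω p := (S ω p - ε / 2 ^ (n + 1)) / (1 + ε)

/-- A round adds S - ε/2^(n+1) to the left side, and the reserve drops from ε/2^n to ε/2^(n+1);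
initially both sides are 1 + ε. -/
lemma F_of_follows [Nonempty (FinProb Ω)] {ε : ℝ} (hε : 0 < ε) {𝒜 : ℕ → Set (Set (Prob Ω))}
    {π : Play Ω} {n : ℕ} (h : ∀ k < n, π.Follows (goodStrategy ε 𝒜) k) :
    (1 + ε) * π.F n = π.K n + ε / 2 ^ n := by
  induction n with
  | zero => simp [Play.F, Play.K]
  | succ n ih =>
    have hf := (h n n.lt_succ_self).2
    have := ih fun k hk => h k (hk.trans n.lt_succ_self)
    have hne : 1 + ε ≠ 0 := by positivity
    rw [Play.F, Play.K, hf, mul_add, this]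
    simp only [goodStrategy]
    rw [mul_div_cancel₀ _ hne, pow_succ]
    field_simp
    ring

end Strategy

end DefensiveForecasting

open DefensiveForecasting
theorem mainTheorem5 {Ω : Type*} [TopologicalSpace Ω] [CompactSpace Ω] [T2Space Ω] [Nonempty Ω]
    (ε : ℝ) (hε : 0 < ε) (𝒜 : ℕ → Set (Set (Prob Ω)))
    (h𝒜_open : ∀ n, ∀ U ∈ 𝒜 n, IsOpen U) (h𝒜_cover : ∀ n, ⋃₀ 𝒜 n = Set.univ) :
    ∃ σ : ForecasterStrategy Ω, ∀ (π : Play Ω) (N : ℕ),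
      (∀ n ≤ N, π.ScepticLegal n ∧ π.Follows σ n ∧ π.RNGLegal n) →
        π.ForecasterLegal N ∧
        π.K (N + 1) ≤ (1 + ε) * π.F (N + 1) ∧
        (∃ U ∈ 𝒜 N, (↑(π N).P.D : Set (Prob Ω)) ⊆ U) ∧
        ((π N).P.D.card : ℕ∞) ≤ ENat.card Ω := by
  have : Nonempty (Prob Ω) := Prob.nonempty
  have : Nonempty (FinProb Ω) := ⟨StdSimplex.single (Classical.arbitrary _)⟩
  refine ⟨goodStrategy ε 𝒜, fun π N h => ?_⟩
  obtain ⟨⟨husc, hint, hpos⟩, ⟨hP, hf⟩, hrng⟩ := h N le_rfl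
  have hF := F_of_follows hε (n := N + 1) fun k hk => (h k (Nat.lt_succ_iff.1 hk)).2.1
  have hδ : 0 < ε / 2 ^ (N + 1) := by positivity
  have hε1 : 0 < 1 + ε := by positivity
  -- The lower bound on S comes from Sceptic's solvency, tested on point masses of `Prob Ω`.
  obtain ⟨hU, hcard, hgood⟩ := Classical.epsilon_spec
    (exists_randomized_forecast (h𝒜_open N) (h𝒜_cover N) husc hint (b := -π.K N)
      (fun ω p => by
        have := hpos (StdSimplex.single p) ω p (by simp [FinProb.D])
        linarith) hδ)
  have hP' : (π N).P = goodForecast (𝒜 N) (ε / 2 ^ (N + 1)) (π N).S := hP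
  have hK : 0 ≤ π.K (N + 1) := hpos (π N).P (π N).outcome (π N).p hrng
  refine ⟨⟨?_, ?_⟩, ?_, by rw [hP']; exact hU, by rw [hP']; exact hcard⟩
  · have h1 : (π N).P.integral ((π N).S (π N).outcome) ≤ ε / 2 ^ (N + 1) := by
      rw [hP']; exact hgood _
    have h2 : (π N).P.integral (π N).f =
        ((π N).P.integral ((π N).S (π N).outcome) - ε / 2 ^ (N + 1)) / (1 + ε) := by
      rw [hf]
      exact FinProb.integral_sub_div _ _ _ _
    rw [h2]
    exact div_nonpos_of_nonpos_of_nonneg (by linarith) hε1.le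
  · exact nonneg_of_mul_nonneg_right (by rw [hF]; linarith) hε1
  · rw [hF]; linarith
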